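/- Let $n\ge 2$, let $B_r\subset\mathbb{R}^n$ be the open ball of radius $r$ centered at the origin, and let $r_2>r_1>0$. Let $f\in C^2(B_{r_2}\setminus\overline{B}_{r_1})\cap C^1(\overline{B}_{r_2}\setminus B_{r_1})$. Write $f_i=\partial_i f$, $f_{ij}=\partial_i\partial_j f$, $|Df|^2=\sum_i f_i^2$, $w=\sqrt{1+|Df|^2}$. Suppose that on $B_{r_2}\setminus\overline{B}_{r_1}$ the mean curvature operator satisfies \[ H(f)=\sum_{i,j=1}^n\Big(\delta_{ij}-\frac{f_if_j}{1+|Df|^2}\Big)\frac{f_{ij}}{\sqrt{1+|Df|^2}}\ \ge 0 , \] and that the scalar curvature of the graph of $f$ in $\mathbb{R}^{n+1}$ is nonnegative there, that is, \[ R(f)=\sum_{i,j=1}^n\big(A^i_iA^j_j-A^i_jA^j_i\big)\ge 0,\qquad A^i_j=\partial_j\Big(\frac{f_i}{w}\Big), \] where $A$ is the shape operator of the graph. Then \[ \max_{\overline{B}_{r_2}\setminus B_{r_1}} f=\max_{\partial B_{r_2}} f . \] Moreover, if $f(x)=\max_{\partial B_{r_2}}f$ for some interior point $x\in B_{r_2}\setminus\overline{B}_{r_1}$,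 then $f\equiv\max_{\partial B_{r_2}}f$ on $\overline{B}_{r_2}\setminus B_{r_1}$. -/

import Mathlib

noncomputable section

namespace GraphGeometry

/-- The partial derivative `∂f/∂xⁱ` at `x`. -/
def partialDeriv {n : ℕ} (i : Fin n) (f : EuclideanSpace ℝ (Fin n) → ℝ)
    (x : EuclideanSpace ℝ (Fin n)) : ℝ :=
  fderiv ℝ f x (EuclideanSpace.single i 1)

/-- `w = √(1 + |Df|²)` at `x`. -/
def slopeFactor {n : ℕ} (f : EuclideanSpace ℝ (Fin n) → ℝ)
    (x : EuclideanSpace ℝ (Fin n)) : ℝ :=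
  Real.sqrt (1 + ∑ k, partialDeriv k f x ^ 2)

/-- The mean curvature operator
`H(f) = ∑ᵢⱼ (δᵢⱼ - fᵢ fⱼ / (1 + |Df|²)) fᵢⱼ / √(1 + |Df|²)`. -/
def meanCurvature {n : ℕ} (f : EuclideanSpace ℝ (Fin n) → ℝ)
    (x : EuclideanSpace ℝ (Fin n)) : ℝ :=
  ∑ i, ∑ j,
    ((if i = j then 1 else 0) -
        partialDeriv i f x * partialDeriv j f x / (1 + ∑ k, partialDeriv k f x ^ 2)) *
      (partialDeriv i (partialDeriv j f) x / slopeFactor f x)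

/-- The shape operator `Aⁱⱼ = ∂ⱼ (fᵢ / w)` of the graph of `f`, in graph coordinates, with respect
to the upward unit normal `ν = (-Df, 1) / w` (that is, `Aⁱⱼ = -∂ⱼ νⁱ` for `i, j ≤ n`). -/
def shapeOperator {n : ℕ} (f : EuclideanSpace ℝ (Fin n) → ℝ)
    (x : EuclideanSpace ℝ (Fin n)) : Matrix (Fin n) (Fin n) ℝ :=
  Matrix.of fun i j => partialDeriv j (fun y => partialDeriv i f y / slopeFactor f y) x

/-- The scalar curvature `R = ∑ᵢⱼ (Aⁱᵢ Aʲⱼ - Aⁱⱼ Aʲᵢ) = 2 σ₂(A)` of the graph of `f` in `ℝⁿ⁺¹`.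
For a graph that is only `C²`, the induced metric is only `C¹`, and its curvature is the one given
by the Gauss equation. -/
def scalarCurvature {n : ℕ} (f : EuclideanSpace ℝ (Fin n) → ℝ)
    (x : EuclideanSpace ℝ (Fin n)) : ℝ :=
  ∑ i, ∑ j, (shapeOperator f x i i * shapeOperator f x j j -
    shapeOperator f x i j * shapeOperator f x j i)

/-- `B_{r₂} \ B̄_{r₁}`, centred at the origin. -/
def openAnnulus (n : ℕ) (r₁ r₂ : ℝ) : Set (EuclideanSpace ℝ (Fin n)) :=
  Metric.ball 0 r₂ \ Metric.closedBall 0 r₁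

/-- `B̄_{r₂} \ B_{r₁}`, centred at the origin. -/
def closedAnnulus (n : ℕ) (r₁ r₂ : ℝ) : Set (EuclideanSpace ℝ (Fin n)) :=
  Metric.closedBall 0 r₂ \ Metric.ball 0 r₁

end GraphGeometry

end

namespace GraphGeometry

open Filter Topology

/-! Where `Df ≠ 0`, let `T` be the trace of the Hessian over the hyperplane orthogonal to `Df`, `a`
the second derivative along the unit vector of `Df`, and `ν = 1 / w²`. Then `w H = T + ν a`, and
discarding the squares of the purely tangential Hessian entries and Cauchy–Schwarz give `w² R ≤ T² +
2 ν a T`. If `T < 0`, then `H ≥ 0` forces `ν a ≥ -T`, so `w² R ≤ -T² < 0`. Hence `H ≥ 0` and `R ≥ 0`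
imply `T ≥ 0` (`tangentialTrace_nonneg`).

A decreasing radial function has level spheres on which this trace is negative, so no function `C
exp(-α |x|²)` with `C, α > 0` can touch `f` from above away from the origin
(`not_isLocalMax_sub_gaussian`). If `f` exceeded its outer maximum inside, a Gaussian small at that
point and huge on the inner sphere would produce such a contact. Thus the inner sphere needs no
boundary condition.

Rigidity uses only `H ≥ 0`: Hopf's argument with the barrier `-ε exp(-α |x - y|²)` makes the contact
set with the maximum open, and the annulus is connected because `n ≥ 2`. -/

/-! ### Second-order conditions at a local maximum -/

theorem IsLocalMax.deriv_deriv_nonpos {g : ℝ → ℝ} {a : ℝ} (h : IsLocalMax g a)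
    (hc : ContinuousAt g a) : deriv (deriv g) a ≤ 0 := by
  by_contra! hpos
  -- A positive second derivative makes `a` a local minimum as well, so `g` is locally constant and
  -- its second derivative vanishes.
  have hmin := isLocalMin_of_deriv_deriv_pos hpos h.deriv_eq_zero hc
  have hconst : g =ᶠ[𝓝 a] fun _ => g a := by
    filter_upwards [h, hmin] with t h₁ h₂ using le_antisymm h₁ h₂
  have := hconst.deriv.deriv_eq
  simp at this
  linarith

theorem IsLocalMax.fderiv_fderiv_nonpos {E : Type*} [NormedAddCommGroup E] [NormedSpace ℝ E]
    {h : E → ℝ} {x : E} (hx : IsLocalMax h x) (hc : ContDiffAt ℝ 2 h x) (v : E) :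
    fderiv ℝ (fderiv ℝ h) x v v ≤ 0 := by
  have hline : ∀ t : ℝ, HasDerivAt (fun t : ℝ => x + t • v) v t := fun t => by
    simpa using ((hasDerivAt_id t).smul_const v).const_add x
  have htend : Tendsto (fun t : ℝ => x + t • v) (𝓝 0) (𝓝 x) := by
    simpa using (hline 0).continuousAt.tendsto
  have hd : ∀ᶠ z in 𝓝 x, DifferentiableAt ℝ h z := by
    filter_upwards [hc.eventually (by simp)] with z hz using hz.differentiableAt (by simp)
  have hfd : DifferentiableAt ℝ (fderiv ℝ h) x :=
    (hc.fderiv_right (m := 1) (by norm_num)).differentiableAt (by simp)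
  have h₁ : deriv (fun t : ℝ => h (x + t • v)) =ᶠ[𝓝 0] fun t => fderiv ℝ h (x + t • v) v := by
    filter_upwards [htend.eventually hd] with t ht
    exact (ht.hasFDerivAt.comp_hasDerivAt t (hline t)).deriv
  have h₂ : HasDerivAt (fun t : ℝ => fderiv ℝ h (x + t • v) v) (fderiv ℝ (fderiv ℝ h) x v v) 0 := by
    have hfd' : HasFDerivAt (fderiv ℝ h) (fderiv ℝ (fderiv ℝ h) x) (x + (0 : ℝ) • v) := by
      simpa using hfd.hasFDerivAt
    have key : HasDerivAt (fun t : ℝ => fderiv ℝ h (x + t • v)) (fderiv ℝ (fderiv ℝ h) x v) 0 :=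
      hfd'.comp_hasDerivAt (0 : ℝ) (hline 0)
    simpa using key.clm_apply (hasDerivAt_const (0 : ℝ) v)
  rw [← h₂.deriv, ← h₁.deriv_eq]
  refine IsLocalMax.deriv_deriv_nonpos ?_ ?_
  · simpa [IsLocalMax, IsMaxFilter] using htend.eventually hx
  · have : ContinuousAt h (x + (0 : ℝ) • v) := by simpa using hc.continuousAt
    exact ContinuousAt.comp (f := fun t : ℝ => x + t • v) this (hline 0).continuousAt

/-! ### Algebra of a symmetric matrix and a distinguished direction -/

variable {n : ℕ}

/-- The quadratic form `∑ᵢⱼ vᵢ vⱼ Fᵢⱼ`. -/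
def quadForm (F : Fin n → Fin n → ℝ) (v : Fin n → ℝ) : ℝ := ∑ i, ∑ j, v i * v j * F i j

/-- The vectors are the projections `P eₖ` onto the hyperplane orthogonal to `p`, so the sum is the
trace of `P F P`. -/
theorem sum_quadForm_tangential {F : Fin n → Fin n → ℝ} (hF : ∀ i j, F i j = F j i)
    {p : Fin n → ℝ} (hp : 0 < ∑ k, p k ^ 2) :
    ∑ k, quadForm F (fun i => (if i = k then 1 else 0) - p k / (∑ l, p l ^ 2) * p i) =
      ∑ k, F k k - quadForm F p / ∑ l, p l ^ 2 := by
  set s := ∑ l, p l ^ 2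
  have hk : ∀ k, quadForm F (fun i => (if i = k then 1 else 0) - p k / s * p i) =
      F k k - 2 / s * (p k * ∑ j, p j * F k j) + p k ^ 2 * (quadForm F p / s ^ 2) := by
    intro k
    have e : ∀ i j, ((if i = k then (1 : ℝ) else 0) - p k / s * p i) *
        ((if j = k then 1 else 0) - p k / s * p j) * F i j =
        (if i = k then (if j = k then F i j else 0) else 0)
        - (if i = k then p k / s * (p j * F i j) else 0)
        - (if j = k then p k / s * (p i * F i j) else 0)
        + p k ^ 2 / s ^ 2 * (p i * p j * F i j) := by
      intro i j
      split_ifs <;> ring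
    simp only [quadForm, e, Finset.sum_add_distrib, Finset.sum_sub_distrib, ← Finset.mul_sum]
    simp only [Finset.sum_ite_irrel, Finset.sum_const_zero, Finset.sum_ite_eq', Finset.mem_univ,
      if_true, ← Finset.mul_sum, hF _ k]
    ring
  simp only [hk, Finset.sum_add_distrib, Finset.sum_sub_distrib, ← Finset.mul_sum,
    ← Finset.sum_mul]
  have hq : ∑ k, p k * ∑ j, p j * F k j = quadForm F p := by
    simp only [quadForm, Finset.mul_sum, mul_assoc]
  rw [hq]
  change _ + s * _ = _
  field_simp
  ring

/-- Pythagoras for the component of `g` orthogonal to `p`. -/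
theorem sum_sq_sub_proj (g p : Fin n → ℝ) (hp : 0 < ∑ k, p k ^ 2) :
    ∑ j, (g j - (∑ k, g k * p k) / (∑ k, p k ^ 2) * p j) ^ 2 =
      ∑ j, g j ^ 2 - (∑ k, g k * p k) ^ 2 / ∑ k, p k ^ 2 := by
  set s := ∑ k, p k ^ 2
  set c := ∑ k, g k * p k
  have e : ∀ j, (g j - c / s * p j) ^ 2 = g j ^ 2 - 2 * c / s * (g j * p j) + c ^ 2 / s ^ 2 * p j ^ 2 :=
    fun j => by ring
  simp only [e, Finset.sum_add_distrib, Finset.sum_sub_distrib, ← Finset.mul_sum]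
  change _ - _ * c + _ * s = _
  field_simp
  ring

theorem sum_mulVec_mul {F : Fin n → Fin n → ℝ} (p : Fin n → ℝ) :
    ∑ k, (∑ l, F k l * p l) * p k = quadForm F p := by
  simp only [quadForm, Finset.sum_mul]
  exact Finset.sum_congr rfl fun i _ => Finset.sum_congr rfl fun j _ => by ring

/-- The Hilbert-Schmidt norm dominates that of the blocks meeting the direction `p`. -/
theorem two_mul_normSq_div_le_normSq {F : Fin n → Fin n → ℝ} (hF : ∀ i j, F i j = F j i)
    {p : Fin n → ℝ} (hp : 0 < ∑ k, p k ^ 2) :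
    2 * (∑ i, (∑ j, F i j * p j) ^ 2) / (∑ k, p k ^ 2) -
      (quadForm F p / ∑ k, p k ^ 2) ^ 2 ≤ ∑ i, ∑ j, F i j ^ 2 := by
  set s := ∑ k, p k ^ 2 with hs
  set u : Fin n → ℝ := fun i => ∑ j, F i j * p j with hu
  have h₁ : ∑ i, ∑ j, (F i j - u i / s * p j) ^ 2 =
      ∑ i, ∑ j, F i j ^ 2 - (∑ i, u i ^ 2) / s := by
    rw [Finset.sum_div, ← Finset.sum_sub_distrib]
    exact Finset.sum_congr rfl fun i _ => sum_sq_sub_proj (F i) p hp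
  have hup : ∑ k, u k * p k = quadForm F p := sum_mulVec_mul p
  -- After the rows of `F` are projected off `p`, Bessel's inequality is applied to each column.
  -- What is dropped is the purely tangential block.
  have h₂ : ∀ j, (u j - quadForm F p / s * p j) ^ 2 / s ≤ ∑ i, (F i j - u i / s * p j) ^ 2 := by
    intro j
    have hv : ∑ i, (F i j - u i / s * p j) * p i = u j - quadForm F p / s * p j := by
      have e : ∀ i, (F i j - u i / s * p j) * p i = F j i * p i - p j / s * (u i * p i) :=
        fun i => by rw [hF i j]; ring
      simp only [e, Finset.sum_sub_distrib, ← Finset.mul_sum, hup]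
      change u j - _ = _
      ring
    have := sum_sq_sub_proj (fun i => F i j - u i / s * p j) p hp
    rw [hv] at this
    have hnn : 0 ≤ ∑ i, (F i j - u i / s * p j - (u j - quadForm F p / s * p j) / s * p i) ^ 2 :=
      Finset.sum_nonneg fun i _ => sq_nonneg _
    linarith
  have h₃ := Finset.sum_le_sum fun j (_ : j ∈ Finset.univ) => h₂ j
  rw [Finset.sum_comm, h₁, ← Finset.sum_div] at h₃
  have h₄ := sum_sq_sub_proj u p hp
  rw [hup] at h₄
  change ∑ j, (u j - quadForm F p / s * p j) ^ 2 = ∑ j, u j ^ 2 - quadForm F p ^ 2 / s at h₄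
  rw [h₄] at h₃
  have e : (∑ j, u j ^ 2 - quadForm F p ^ 2 / s) / s =
    (∑ j, u j ^ 2) / s - (quadForm F p / s) ^ 2 := by field_simp
  have e' : 2 * (∑ j, u j ^ 2) / s = 2 * ((∑ j, u j ^ 2) / s) := by ring
  rw [e] at h₃
  change 2 * (∑ j, u j ^ 2) / s - _ ≤ _
  rw [e']
  linarith

theorem sq_quadForm_le {F : Fin n → Fin n → ℝ} {p : Fin n → ℝ} :
    quadForm F p ^ 2 ≤ (∑ i, (∑ j, F i j * p j) ^ 2) * ∑ k, p k ^ 2 := by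
  rw [← sum_mulVec_mul]
  exact Finset.sum_mul_sq_le_sq_mul_sq _ _ _

/-! ### Partial derivatives and the Hessian -/

theorem ContDiffAt.differentiableAt_partialDeriv {f : EuclideanSpace ℝ (Fin n) → ℝ}
    {x : EuclideanSpace ℝ (Fin n)} (hf : ContDiffAt ℝ 2 f x) (j : Fin n) :
    DifferentiableAt ℝ (partialDeriv j f) x := by
  have h := (hf.fderiv_right (m := 1) (by norm_num)).differentiableAt (by simp)
  exact h.clm_apply (differentiableAt_const (EuclideanSpace.single j (1 : ℝ)))

theorem ContDiffAt.partialDeriv_partialDeriv {f : EuclideanSpace ℝ (Fin n) → ℝ}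
    {x : EuclideanSpace ℝ (Fin n)} (hf : ContDiffAt ℝ 2 f x) (i j : Fin n) :
    partialDeriv i (partialDeriv j f) x =
      fderiv ℝ (fderiv ℝ f) x (EuclideanSpace.single i 1) (EuclideanSpace.single j 1) := by
  have h := (hf.fderiv_right (m := 1) (by norm_num)).differentiableAt (by simp)
  have := (h.hasFDerivAt.clm_apply
    (hasFDerivAt_const (EuclideanSpace.single j (1 : ℝ)) x)).fderiv
  unfold partialDeriv
  rw [this]
  simp

theorem ContDiffAt.partialDeriv_comm {f : EuclideanSpace ℝ (Fin n) → ℝ}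
    {x : EuclideanSpace ℝ (Fin n)} (hf : ContDiffAt ℝ 2 f x) (i j : Fin n) :
    partialDeriv i (partialDeriv j f) x = partialDeriv j (partialDeriv i f) x := by
  rw [ContDiffAt.partialDeriv_partialDeriv hf, ContDiffAt.partialDeriv_partialDeriv hf]
  exact hf.isSymmSndFDerivAt (by simp) _ _

theorem ContDiffAt.fderiv_fderiv_eq_quadForm {f : EuclideanSpace ℝ (Fin n) → ℝ}
    {x : EuclideanSpace ℝ (Fin n)} (hf : ContDiffAt ℝ 2 f x) (v : EuclideanSpace ℝ (Fin n)) :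
    fderiv ℝ (fderiv ℝ f) x v v =
      quadForm (fun i j => partialDeriv i (partialDeriv j f) x) v := by
  have hv : v = ∑ i, v i • EuclideanSpace.single i (1 : ℝ) := by
    ext k
    simp [Pi.single_apply]
  conv_lhs => rw [hv]
  simp only [quadForm, ContDiffAt.partialDeriv_partialDeriv hf, map_sum, map_smul,
    _root_.sum_apply, _root_.smul_apply, smul_eq_mul, Finset.mul_sum]
  rw [Finset.sum_comm]
  exact Finset.sum_congr rfl fun i _ => Finset.sum_congr rfl fun j _ => by ring

theorem partialDeriv_sub {f g : EuclideanSpace ℝ (Fin n) → ℝ} {x : EuclideanSpace ℝ (Fin n)}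
    (hf : DifferentiableAt ℝ f x) (hg : DifferentiableAt ℝ g x) (i : Fin n) :
    partialDeriv i (fun z => f z - g z) x = partialDeriv i f x - partialDeriv i g x := by
  simp [partialDeriv, fderiv_fun_sub hf hg]

theorem ContDiffAt.partialDeriv_partialDeriv_sub {f g : EuclideanSpace ℝ (Fin n) → ℝ}
    {x : EuclideanSpace ℝ (Fin n)} (hf : ContDiffAt ℝ 2 f x) (hg : ContDiffAt ℝ 2 g x)
    (i j : Fin n) :
    partialDeriv i (partialDeriv j fun z => f z - g z) x =
      partialDeriv i (partialDeriv j f) x - partialDeriv i (partialDeriv j g) x := by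
  have h : partialDeriv j (fun z => f z - g z) =ᶠ[𝓝 x]
      fun z => partialDeriv j f z - partialDeriv j g z := by
    filter_upwards [hf.eventually (by simp), hg.eventually (by simp)] with z h₁ h₂
    exact partialDeriv_sub (h₁.differentiableAt (by simp)) (h₂.differentiableAt (by simp)) j
  rw [← partialDeriv_sub (ContDiffAt.differentiableAt_partialDeriv hf j)
    (ContDiffAt.differentiableAt_partialDeriv hg j), partialDeriv, h.fderiv_eq, partialDeriv]

/-! ### Gaussian comparison functions -/

/-- The function `C exp(-α |x - y|²)`. -/
noncomputable def gaussian (C α : ℝ) (y x : EuclideanSpace ℝ (Fin n)) : ℝ := C * Real.exp (-α * ‖x - y‖ ^ 2)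

theorem contDiff_gaussian (C α : ℝ) (y : EuclideanSpace ℝ (Fin n)) :
    ContDiff ℝ 2 (gaussian C α y) := by
  unfold gaussian
  exact contDiff_const.mul (contDiff_const.mul ((contDiff_id.sub contDiff_const).norm_sq ℝ)).exp

theorem hasFDerivAt_gaussian (C α : ℝ) (y x : EuclideanSpace ℝ (Fin n)) :
    HasFDerivAt (gaussian C α y) ((-2 * α * gaussian C α y x) • innerSL ℝ (x - y)) x := by
  have h₁ : HasFDerivAt (fun x => ‖x - y‖ ^ 2) (2 • innerSL ℝ (x - y)) x := by
    have := ((hasFDerivAt_id x).sub_const y).norm_sq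
    simpa using this
  have := ((h₁.const_mul (-α)).exp).const_mul C
  refine this.congr_fderiv ?_
  ext v
  simp [gaussian]
  ring

theorem partialDeriv_gaussian (C α : ℝ) (y x : EuclideanSpace ℝ (Fin n)) (i : Fin n) :
    partialDeriv i (gaussian C α y) x = -2 * α * gaussian C α y x * (x i - y i) := by
  rw [partialDeriv, (hasFDerivAt_gaussian C α y x).fderiv]
  simp [EuclideanSpace.inner_single_right]

theorem partialDeriv_partialDeriv_gaussian (C α : ℝ) (y x : EuclideanSpace ℝ (Fin n))
    (i j : Fin n) :
    partialDeriv i (partialDeriv j (gaussian C α y)) x = gaussian C α y x *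
      (4 * α ^ 2 * ((x i - y i) * (x j - y j)) - 2 * α * if i = j then 1 else 0) := by
  have e : partialDeriv j (gaussian C α y) =
      fun x => -2 * α * gaussian C α y x * (x j - y j) :=
    funext fun x => partialDeriv_gaussian C α y x j
  have h₂ : HasFDerivAt (fun x : EuclideanSpace ℝ (Fin n) => x j - y j)
      (EuclideanSpace.proj j : EuclideanSpace ℝ (Fin n) →L[ℝ] ℝ) x :=
    (EuclideanSpace.proj j : EuclideanSpace ℝ (Fin n) →L[ℝ] ℝ).hasFDerivAt.sub_const _
  rw [e, partialDeriv, (((hasFDerivAt_gaussian C α y x).const_mul (-2 * α)).fun_mul h₂).fderiv]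
  simp [EuclideanSpace.inner_single_right, PiLp.single_apply, eq_comm (a := j)]
  split_ifs <;> ring

/-- First and second order conditions at a point where `C exp(-α |x - y|²)` touches `f` from
above. -/
theorem IsLocalMax.sub_gaussian {f : EuclideanSpace ℝ (Fin n) → ℝ}
    {x y : EuclideanSpace ℝ (Fin n)} {C α : ℝ} (hf : ContDiffAt ℝ 2 f x)
    (hx : IsLocalMax (fun z => f z - gaussian C α y z) x) :
    (∀ i, partialDeriv i f x = -2 * α * gaussian C α y x * (x i - y i)) ∧
    ∀ v : Fin n → ℝ, quadForm (fun i j => partialDeriv i (partialDeriv j f) x) v ≤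
      gaussian C α y x *
        (4 * α ^ 2 * (∑ i, (x i - y i) * v i) ^ 2 - 2 * α * ∑ i, v i ^ 2) := by
  have hg : ContDiffAt ℝ 2 (gaussian C α y) x := (contDiff_gaussian C α y).contDiffAt
  constructor
  · intro i
    have h := partialDeriv_sub (hf.differentiableAt (by simp)) (hg.differentiableAt (by simp)) i
    have h0 : partialDeriv i (fun z => f z - gaussian C α y z) x = 0 := by
      rw [partialDeriv, hx.fderiv_eq_zero]; simp
    rw [← partialDeriv_gaussian]
    linarith
  · intro v
    have h := IsLocalMax.fderiv_fderiv_nonpos hx (hf.sub hg) (WithLp.toLp 2 v)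
    rw [ContDiffAt.fderiv_fderiv_eq_quadForm (hf.sub hg)] at h
    simp only [quadForm, ContDiffAt.partialDeriv_partialDeriv_sub hf hg,
      partialDeriv_partialDeriv_gaussian] at h
    have e : ∀ i j, v i * v j * (partialDeriv i (partialDeriv j f) x - gaussian C α y x *
        (4 * α ^ 2 * ((x i - y i) * (x j - y j)) - 2 * α * if i = j then 1 else 0)) =
        v i * v j * partialDeriv i (partialDeriv j f) x -
        v i * v j * (gaussian C α y x * (4 * α ^ 2 * ((x i - y i) * (x j - y j)))) +
        v i * v j * (gaussian C α y x * (2 * α * if i = j then 1 else 0)) :=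
      fun i j => by ring
    simp only [e, Finset.sum_add_distrib, Finset.sum_sub_distrib] at h
    have e₁ : ∑ i, ∑ j, v i * v j * (gaussian C α y x *
        (4 * α ^ 2 * ((x i - y i) * (x j - y j)))) =
        gaussian C α y x * (4 * α ^ 2 * (∑ i, (x i - y i) * v i) ^ 2) := by
      rw [sq (∑ i, _), Finset.sum_mul_sum]
      simp only [Finset.mul_sum]
      exact Finset.sum_congr rfl fun i _ => Finset.sum_congr rfl fun j _ => by ring
    have e₂ : ∑ i, ∑ j, v i * v j * (gaussian C α y x * (2 * α * if i = j then 1 else 0)) =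
        gaussian C α y x * (2 * α * ∑ i, v i ^ 2) := by
      simp only [mul_ite, mul_one, mul_zero, Finset.sum_ite_eq, Finset.mem_univ, if_true,
        Finset.mul_sum]
      exact Finset.sum_congr rfl fun i _ => by ring
    rw [e₁, e₂] at h
    rw [quadForm, mul_sub]
    linarith

/-! ### Curvatures in terms of gradient and Hessian -/

theorem slopeFactor_pos (f : EuclideanSpace ℝ (Fin n) → ℝ) (x : EuclideanSpace ℝ (Fin n)) :
    0 < slopeFactor f x :=
  Real.sqrt_pos.2 (by positivity)

theorem slopeFactor_sq (f : EuclideanSpace ℝ (Fin n) → ℝ) (x : EuclideanSpace ℝ (Fin n)) :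
    slopeFactor f x ^ 2 = 1 + ∑ k, partialDeriv k f x ^ 2 :=
  Real.sq_sqrt (by positivity)

theorem shapeOperator_apply {f : EuclideanSpace ℝ (Fin n) → ℝ} {x : EuclideanSpace ℝ (Fin n)}
    (hf : ContDiffAt ℝ 2 f x) (i j : Fin n) :
    shapeOperator f x i j = partialDeriv i (partialDeriv j f) x / slopeFactor f x -
      partialDeriv i f x * (∑ k, partialDeriv j (partialDeriv k f) x * partialDeriv k f x) /
        slopeFactor f x ^ 3 := by
  have hd := fun k => (ContDiffAt.differentiableAt_partialDeriv hf k).hasFDerivAt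
  have hs : HasFDerivAt (fun y => 1 + ∑ k, partialDeriv k f y ^ 2)
      (∑ k, (2 * partialDeriv k f x) • fderiv ℝ (partialDeriv k f) x) x := by
    refine (HasFDerivAt.fun_sum fun k _ => ?_).const_add 1
    simpa using (hd k).pow 2
  have hw : HasFDerivAt (slopeFactor f) _ x :=
    hs.sqrt (by positivity : (0 : ℝ) < 1 + ∑ k, partialDeriv k f x ^ 2).ne'
  have hw0 := (slopeFactor_pos f x).ne'
  have hinv := (hasDerivAt_inv hw0).comp_hasFDerivAt x hw
  have := ((hd i).fun_mul hinv).fderiv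
  rw [shapeOperator, Matrix.of_apply, partialDeriv]
  simp only [div_eq_mul_inv]
  refine (congrArg (fun L => L (EuclideanSpace.single j 1)) this).trans ?_
  have e : ∑ k, 2 * partialDeriv k f x * partialDeriv j (partialDeriv k f) x =
      2 * ∑ k, partialDeriv j (partialDeriv k f) x * partialDeriv k f x := by
    rw [Finset.mul_sum]
    exact Finset.sum_congr rfl fun i _ => by ring
  have hj : ∀ k, fderiv ℝ (partialDeriv k f) x (EuclideanSpace.single j 1) =
    partialDeriv j (partialDeriv k f) x := fun _ => rfl
  have hsq : √(1 + ∑ k, partialDeriv k f x ^ 2) = slopeFactor f x := rfl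
  simp only [_root_.smul_apply, _root_.add_apply, _root_.sum_apply, smul_eq_mul, hj, e, hsq,
    Function.comp_apply, ContDiffAt.partialDeriv_comm hf i j]
  field_simp
  ring

theorem slopeFactor_mul_meanCurvature (f : EuclideanSpace ℝ (Fin n) → ℝ)
    (x : EuclideanSpace ℝ (Fin n)) :
    slopeFactor f x * meanCurvature f x = ∑ k, partialDeriv k (partialDeriv k f) x -
      quadForm (fun i j => partialDeriv i (partialDeriv j f) x) (fun i => partialDeriv i f x) /
        (1 + ∑ k, partialDeriv k f x ^ 2) := by
  have hw := (slopeFactor_pos f x).ne'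
  rw [meanCurvature, Finset.mul_sum, quadForm, Finset.sum_div, ← Finset.sum_sub_distrib]
  refine Finset.sum_congr rfl fun i _ => ?_
  rw [Finset.mul_sum, Finset.sum_div]
  have e : ∀ j, slopeFactor f x * (((if i = j then (1 : ℝ) else 0) -
        partialDeriv i f x * partialDeriv j f x / (1 + ∑ k, partialDeriv k f x ^ 2)) *
      (partialDeriv i (partialDeriv j f) x / slopeFactor f x)) =
      (if i = j then partialDeriv i (partialDeriv j f) x else 0) -
      partialDeriv i f x * partialDeriv j f x * partialDeriv i (partialDeriv j f) x /
        (1 + ∑ k, partialDeriv k f x ^ 2) := by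
    intro j
    split_ifs <;> field_simp
    ring
  simp only [e, Finset.sum_sub_distrib, Finset.sum_ite_eq, Finset.mem_univ, if_true]

theorem scalarCurvature_eq (f : EuclideanSpace ℝ (Fin n) → ℝ) (x : EuclideanSpace ℝ (Fin n)) :
    scalarCurvature f x = (∑ i, shapeOperator f x i i) ^ 2 -
      ∑ i, ∑ j, shapeOperator f x i j * shapeOperator f x j i := by
  simp only [scalarCurvature, Finset.sum_sub_distrib]
  rw [sq, Finset.sum_mul_sum]

theorem sum_shapeOperator {f : EuclideanSpace ℝ (Fin n) → ℝ} {x : EuclideanSpace ℝ (Fin n)}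
    (hf : ContDiffAt ℝ 2 f x) : ∑ i, shapeOperator f x i i = meanCurvature f x := by
  have hw := (slopeFactor_pos f x).ne'
  have h := slopeFactor_mul_meanCurvature f x
  rw [← slopeFactor_sq] at h
  refine mul_left_cancel₀ hw (Eq.trans ?_ h.symm)
  simp only [shapeOperator_apply hf, Finset.sum_sub_distrib, ← Finset.sum_div, mul_sub]
  rw [← sum_mulVec_mul]
  simp only [mul_comm (partialDeriv _ f x) (∑ k, _)]
  field_simp

/-- With `F` the Hessian and `p` the gradient, `w A = (I - p pᵀ / w²) F`; this is the expansion of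
the trace of its square. -/
theorem sum_shapeOperator_mul {f : EuclideanSpace ℝ (Fin n) → ℝ} {x : EuclideanSpace ℝ (Fin n)}
    (hf : ContDiffAt ℝ 2 f x) :
    slopeFactor f x ^ 2 * ∑ i, ∑ j, shapeOperator f x i j * shapeOperator f x j i =
      ∑ i, ∑ j, partialDeriv i (partialDeriv j f) x ^ 2 -
      2 * (∑ i, (∑ j, partialDeriv i (partialDeriv j f) x * partialDeriv j f x) ^ 2) /
        slopeFactor f x ^ 2 +
      (quadForm (fun i j => partialDeriv i (partialDeriv j f) x) (fun i => partialDeriv i f x) /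
        slopeFactor f x ^ 2) ^ 2 := by
  have hw := (slopeFactor_pos f x).ne'
  have hq := sum_mulVec_mul (F := fun i j => partialDeriv i (partialDeriv j f) x)
    (fun i => partialDeriv i f x)
  simp only [shapeOperator_apply hf]
  set w := slopeFactor f x
  set F : Fin n → Fin n → ℝ := fun i j => partialDeriv i (partialDeriv j f) x with hF
  set p : Fin n → ℝ := fun i => partialDeriv i f x with hp
  set u : Fin n → ℝ := fun i => ∑ j, F i j * p j with hu
  have hsymm : ∀ i j, F i j = F j i := fun i j => ContDiffAt.partialDeriv_comm hf i j
  change ∑ k, u k * p k = quadForm F p at hq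
  change w ^ 2 * ∑ i, ∑ j, (F i j / w - p i * u j / w ^ 3) * (F j i / w - p j * u i / w ^ 3) =
    ∑ i, ∑ j, F i j ^ 2 - 2 * (∑ i, u i ^ 2) / w ^ 2 + (quadForm F p / w ^ 2) ^ 2
  have e : ∀ i j, (F i j / w - p i * u j / w ^ 3) * (F j i / w - p j * u i / w ^ 3) =
      F i j ^ 2 / w ^ 2 - u i * (F i j * p j) / w ^ 4 - u j * (F j i * p i) / w ^ 4 +
      (u i * p i) * (u j * p j) / w ^ 6 := fun i j => by
    rw [hsymm j i]; field_simp; ring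
  have h₁ : ∑ i, ∑ j, u i * (F i j * p j) = ∑ i, u i ^ 2 :=
    Finset.sum_congr rfl fun i _ => by rw [← Finset.mul_sum, sq]
  have h₂ : ∑ i, ∑ j, u j * (F j i * p i) = ∑ i, u i ^ 2 := by rw [Finset.sum_comm, h₁]
  have h₃ : ∑ i, ∑ j, (u i * p i) * (u j * p j) = quadForm F p ^ 2 := by
    rw [← Finset.sum_mul_sum, hq, sq]
  simp only [e, Finset.sum_add_distrib, Finset.sum_sub_distrib, ← Finset.sum_div, h₁, h₂, h₃]
  field_simp
  ring

/-- If the mean curvature and the scalar curvature of the graph are nonnegative, the trace of the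
Hessian over the directions tangential to the level set is nonnegative. -/
theorem tangentialTrace_nonneg {f : EuclideanSpace ℝ (Fin n) → ℝ} {x : EuclideanSpace ℝ (Fin n)}
    (hf : ContDiffAt ℝ 2 f x) (hp : 0 < ∑ k, partialDeriv k f x ^ 2)
    (hH : 0 ≤ meanCurvature f x) (hR : 0 ≤ scalarCurvature f x) :
    0 ≤ ∑ k, partialDeriv k (partialDeriv k f) x -
      quadForm (fun i j => partialDeriv i (partialDeriv j f) x) (fun i => partialDeriv i f x) /
        ∑ k, partialDeriv k f x ^ 2 := by
  have h₁ := slopeFactor_mul_meanCurvature f x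
  have h₂ := sum_shapeOperator_mul hf
  have hwH := mul_nonneg (slopeFactor_pos f x).le hH
  have hwR : 0 ≤ slopeFactor f x ^ 2 * scalarCurvature f x := by positivity
  rw [scalarCurvature_eq, sum_shapeOperator hf, mul_sub, h₂, ← mul_pow, h₁] at hwR
  rw [h₁] at hwH
  have h₃ := two_mul_normSq_div_le_normSq
    (F := fun i j => partialDeriv i (partialDeriv j f) x)
    (fun i j => ContDiffAt.partialDeriv_comm hf i j) hp
  have h₄ := sq_quadForm_le (F := fun i j => partialDeriv i (partialDeriv j f) x)
    (p := fun i => partialDeriv i f x)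
  rw [slopeFactor_sq] at hwR
  generalize ∑ k, partialDeriv k (partialDeriv k f) x = τ at *
  generalize quadForm (fun i j => partialDeriv i (partialDeriv j f) x)
    (fun i => partialDeriv i f x) = q at *
  generalize ∑ i, ∑ j, partialDeriv i (partialDeriv j f) x ^ 2 = N at *
  generalize ∑ i, (∑ j, partialDeriv i (partialDeriv j f) x * partialDeriv j f x) ^ 2 = t at *
  generalize ∑ k, partialDeriv k f x ^ 2 = s at *
  by_contra! hT
  -- Normalised quantities: `a` is the second derivative along the unit gradient, `b = |F p|² /
  -- |p|²`, `T` is the tangential trace and `ν = 1 / w²`.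
  obtain ⟨a, rfl⟩ : ∃ a, q = s * a := ⟨q / s, by field_simp⟩
  obtain ⟨b, rfl⟩ : ∃ b, t = s * b := ⟨t / s, by field_simp⟩
  obtain ⟨T, rfl⟩ : ∃ T, τ = T + a := ⟨τ - a, by ring⟩
  obtain ⟨ν, hν⟩ : ∃ ν, ν = 1 / (1 + s) := ⟨_, rfl⟩
  have hν0 : 0 < ν := by rw [hν]; positivity
  have hsν : s / (1 + s) = 1 - ν := by rw [hν]; field_simp; ring
  have e₁ : s * a / s = a := by field_simp
  have e₂ : 2 * (s * b) / s = 2 * b := by field_simp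
  have e₃ : s * a / (1 + s) = (1 - ν) * a := by rw [← hsν]; ring
  have e₄ : 2 * (s * b) / (1 + s) = 2 * (1 - ν) * b := by rw [← hsν]; ring
  rw [e₁] at hT h₃
  rw [e₂] at h₃
  rw [e₃] at hwH hwR
  rw [e₄] at hwR
  have hab : a ^ 2 ≤ b := by
    have : s ^ 2 * a ^ 2 ≤ s ^ 2 * b := by linarith
    exact le_of_mul_le_mul_left this (by positivity)
  have hT' : T < 0 := by linarith
  have hνa : -T ≤ ν * a := by linarith
  -- The bounds combine to `0 ≤ w² R ≤ T² + 2 ν a T - 2 ν (b - a²) ≤ T² + 2 ν a T ≤ -T²`, against `T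
  -- < 0`.
  nlinarith [mul_le_mul_of_nonneg_left hab hν0.le, mul_le_mul_of_nonpos_left hνa hT'.le,
    mul_pos_of_neg_of_neg hT' hT']

/-! ### Contact with a Gaussian -/

/-- The tangential trace and the radial second derivative of a function touched from above by
`C exp(-α |x - y|²)`. -/
theorem IsLocalMax.tangentialTrace_le {f : EuclideanSpace ℝ (Fin n) → ℝ}
    {x y : EuclideanSpace ℝ (Fin n)} {C α : ℝ} (hf : ContDiffAt ℝ 2 f x)
    (hx : IsLocalMax (fun z => f z - gaussian C α y z) x)
    (hxy : x ≠ y) (hC : C ≠ 0) (hα : α ≠ 0) :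
    (∑ k, partialDeriv k f x ^ 2 = (2 * α * gaussian C α y x) ^ 2 * ‖x - y‖ ^ 2) ∧
    0 < ∑ k, partialDeriv k f x ^ 2 ∧
    ∑ k, partialDeriv k (partialDeriv k f) x -
      quadForm (fun i j => partialDeriv i (partialDeriv j f) x) (fun i => partialDeriv i f x) /
        (∑ k, partialDeriv k f x ^ 2) ≤ gaussian C α y x * (-2 * α * (n - 1)) ∧
    quadForm (fun i j => partialDeriv i (partialDeriv j f) x) (fun i => partialDeriv i f x) /
        (∑ k, partialDeriv k f x ^ 2) ≤
      gaussian C α y x * (4 * α ^ 2 * ‖x - y‖ ^ 2 - 2 * α) := by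
  obtain ⟨h₁, h₂⟩ := IsLocalMax.sub_gaussian hf hx
  -- The sign of `C` stays free: `C > 0` serves the bound by the outer sphere, `C < 0` Hopf's
  -- argument.
  have hφ : gaussian C α y x ≠ 0 := mul_ne_zero hC (Real.exp_pos _).ne'
  set φ := gaussian C α y x
  have hnorm : ∑ i, (x i - y i) ^ 2 = ‖x - y‖ ^ 2 := by
    rw [EuclideanSpace.norm_sq_eq]; simp
  have hsum : ∑ k, partialDeriv k f x ^ 2 = (2 * α * φ) ^ 2 * ‖x - y‖ ^ 2 := by
    rw [← hnorm, Finset.mul_sum]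
    exact Finset.sum_congr rfl fun i _ => by rw [h₁]; ring
  have hr : 0 < ‖x - y‖ := norm_pos_iff.2 (sub_ne_zero.2 hxy)
  have hpos : 0 < ∑ k, partialDeriv k f x ^ 2 := by rw [hsum]; positivity
  have hzp : ∑ i, (x i - y i) * partialDeriv i f x = -2 * α * φ * ‖x - y‖ ^ 2 := by
    rw [← hnorm, Finset.mul_sum]
    exact Finset.sum_congr rfl fun i _ => by rw [h₁]; ring
  refine ⟨hsum, hpos, ?_, ?_⟩
  · have ht := sum_quadForm_tangential (F := fun i j => partialDeriv i (partialDeriv j f) x)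
      (fun i j => ContDiffAt.partialDeriv_comm hf i j) hpos
    rw [← ht]
    set s := ∑ k, partialDeriv k f x ^ 2
    have hk : ∀ k, quadForm (fun i j => partialDeriv i (partialDeriv j f) x) (fun i =>
        (if i = k then 1 else 0) - partialDeriv k f x / s * partialDeriv i f x) ≤
        φ * (-2 * α * (1 - partialDeriv k f x ^ 2 / s)) := by
      intro k
      refine (h₂ _).trans (le_of_eq ?_)
      -- At the contact point `Df` is parallel to `x - y`, so tangential vectors do not see the `α²`
      -- term of the Gaussian's Hessian.
      have a₁ : ∑ i, (x i - y i) * ((if i = k then 1 else 0) -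
          partialDeriv k f x / s * partialDeriv i f x) = 0 := by
        have e : ∀ i, (x i - y i) * ((if i = k then 1 else 0) -
          partialDeriv k f x / s * partialDeriv i f x) = (if i = k then x i - y i else 0) -
          partialDeriv k f x / s * ((x i - y i) * partialDeriv i f x) := fun i => by
            split_ifs <;> ring
        simp only [e, Finset.sum_sub_distrib, ← Finset.mul_sum, hzp, Finset.sum_ite_eq',
          Finset.mem_univ, if_true]
        rw [h₁ k, hsum]
        field_simp
        ring
      have a₂ : ∑ i, ((if i = k then (1 : ℝ) else 0) -
          partialDeriv k f x / s * partialDeriv i f x) ^ 2 = 1 - partialDeriv k f x ^ 2 / s := by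
        have e : ∀ i, ((if i = k then (1 : ℝ) else 0) -
          partialDeriv k f x / s * partialDeriv i f x) ^ 2 =
          (if i = k then 1 - 2 * (partialDeriv k f x / s * partialDeriv i f x) else 0) +
          (partialDeriv k f x / s) ^ 2 * partialDeriv i f x ^ 2 := fun i => by
            split_ifs <;> ring
        simp only [e, Finset.sum_add_distrib, ← Finset.mul_sum, Finset.sum_ite_eq',
          Finset.mem_univ, if_true]
        change _ + _ * s = _
        field_simp
        ring
      rw [a₁, a₂]
      ring
    refine (Finset.sum_le_sum fun k _ => hk k).trans (le_of_eq ?_)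
    rw [← Finset.mul_sum, ← Finset.mul_sum, Finset.sum_sub_distrib, ← Finset.sum_div]
    change φ * (_ * (_ - s / s)) = _
    rw [div_self hpos.ne']
    simp
  · rw [div_le_iff₀ hpos]
    refine (h₂ _).trans (le_of_eq ?_)
    rw [hzp, hsum]
    ring

theorem not_isLocalMax_sub_gaussian (hn : 2 ≤ n) {f : EuclideanSpace ℝ (Fin n) → ℝ}
    {x y : EuclideanSpace ℝ (Fin n)} {C α : ℝ} (hf : ContDiffAt ℝ 2 f x)
    (hH : 0 ≤ meanCurvature f x) (hR : 0 ≤ scalarCurvature f x)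
    (hxy : x ≠ y) (hC : 0 < C) (hα : 0 < α) :
    ¬ IsLocalMax (fun z => f z - gaussian C α y z) x := by
  intro hx
  obtain ⟨-, hpos, hT, -⟩ := IsLocalMax.tangentialTrace_le hf hx hxy hC.ne' hα.ne'
  have h := (tangentialTrace_nonneg hf hpos hH hR).trans hT
  have hφ : 0 < gaussian C α y x := mul_pos hC (Real.exp_pos _)
  have hn' : (0 : ℝ) < n - 1 := by
    have : (2 : ℝ) ≤ n := by exact_mod_cast hn
    linarith
  have : 0 < gaussian C α y x * (2 * α * (n - 1)) := by positivity
  linarith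

/-- For large `α |x - y|²` the negative radial second derivative outweighs the positive bound on the
tangential trace. In `H` it carries the factor `1 / (1 + |Df|²)`, which the small-slope hypothesis
keeps at least `1 / 2`. -/
theorem IsLocalMax.meanCurvature_neg {f : EuclideanSpace ℝ (Fin n) → ℝ}
    {x y : EuclideanSpace ℝ (Fin n)} {C α : ℝ} (hf : ContDiffAt ℝ 2 f x)
    (hx : IsLocalMax (fun z => f z - gaussian C α y z) x)
    (hxy : x ≠ y) (hC : C < 0) (hα : 0 < α) (hα' : n ≤ α * ‖x - y‖ ^ 2)
    (hs : (2 * α * gaussian C α y x) ^ 2 * ‖x - y‖ ^ 2 ≤ 1) (hn : 1 ≤ n) :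
    meanCurvature f x < 0 := by
  obtain ⟨hsum, hpos, hT, hq⟩ := IsLocalMax.tangentialTrace_le hf hx hxy hC.ne hα.ne'
  have hφ : gaussian C α y x < 0 := mul_neg_of_neg_of_pos hC (Real.exp_pos _)
  have hw := slopeFactor_mul_meanCurvature f x
  rw [← hsum] at hs
  suffices slopeFactor f x * meanCurvature f x < 0 by
    by_contra! h
    exact absurd (mul_nonneg (slopeFactor_pos f x).le h) this.not_ge
  rw [hw]
  generalize ∑ k, partialDeriv k (partialDeriv k f) x = τ at *
  generalize quadForm (fun i j => partialDeriv i (partialDeriv j f) x)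
    (fun i => partialDeriv i f x) = q at *
  generalize ∑ k, partialDeriv k f x ^ 2 = s at *
  generalize gaussian C α y x = φ at *
  have hn' : (1 : ℝ) ≤ n := by exact_mod_cast hn
  obtain ⟨b, rfl⟩ : ∃ b, q = s * b := ⟨q / s, by field_simp⟩
  rw [mul_div_cancel_left₀ _ hpos.ne'] at hT hq
  have e : s * b / (1 + s) = b - b / (1 + s) := by field_simp; ring
  rw [e]
  have hb₁ : b ≤ φ * α * (4 * n - 2) := by
    refine hq.trans ?_
    have := mul_le_mul_of_nonpos_left hα' (mul_neg_of_neg_of_pos hφ hα).le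
    nlinarith
  have hφα : φ * α < 0 := mul_neg_of_neg_of_pos hφ hα
  have hb : b ≤ 0 := hb₁.trans (mul_nonpos_of_nonpos_of_nonneg hφα.le (by linarith))
  have hb₂ : b / (1 + s) ≤ b / 2 := by
    rw [div_le_div_iff₀ (by linarith) (by norm_num)]
    nlinarith
  -- The tangential part is at most `-2 φ α (n - 1)` and the radial part at most `φ α (2 n - 1)`;
  -- their sum is `φ α < 0`.
  nlinarith

/-! ### Topology of the annuli -/

theorem mem_openAnnulus {r₁ r₂ : ℝ} {x : EuclideanSpace ℝ (Fin n)} :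
    x ∈ openAnnulus n r₁ r₂ ↔ ‖x‖ < r₂ ∧ r₁ < ‖x‖ := by
  simp [openAnnulus]

theorem mem_closedAnnulus {r₁ r₂ : ℝ} {x : EuclideanSpace ℝ (Fin n)} :
    x ∈ closedAnnulus n r₁ r₂ ↔ ‖x‖ ≤ r₂ ∧ r₁ ≤ ‖x‖ := by
  simp [closedAnnulus]

theorem isOpen_openAnnulus (r₁ r₂ : ℝ) : IsOpen (openAnnulus n r₁ r₂) :=
  Metric.isOpen_ball.sdiff Metric.isClosed_closedBall

theorem openAnnulus_subset_closedAnnulus (r₁ r₂ : ℝ) :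
    openAnnulus n r₁ r₂ ⊆ closedAnnulus n r₁ r₂ := fun x hx => by
  rw [mem_openAnnulus] at hx
  exact mem_closedAnnulus.2 ⟨hx.1.le, hx.2.le⟩

theorem isCompact_closedAnnulus (r₁ r₂ : ℝ) : IsCompact (closedAnnulus n r₁ r₂) :=
  (isCompact_closedBall 0 r₂).diff Metric.isOpen_ball

theorem isPreconnected_openAnnulus (hn : 2 ≤ n) {r₁ r₂ : ℝ} (hr₁ : 0 < r₁) :
    IsPreconnected (openAnnulus n r₁ r₂) := by
  have hrank : 1 < Module.rank ℝ (EuclideanSpace ℝ (Fin n)) := by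
    rw [← Module.finrank_eq_rank, finrank_euclideanSpace_fin]
    exact_mod_cast hn
  -- Polar coordinates reduce connectedness to that of the unit sphere, where dimension at least two
  -- enters.
  have himage : openAnnulus n r₁ r₂ = (fun q : ℝ × EuclideanSpace ℝ (Fin n) => q.1 • q.2) ''
      (Set.Ioo r₁ r₂ ×ˢ Metric.sphere 0 1) := by
    ext x
    rw [mem_openAnnulus]
    constructor
    · rintro ⟨h₁, h₂⟩
      have h0 : 0 < ‖x‖ := hr₁.trans h₂
      refine ⟨(‖x‖, ‖x‖⁻¹ • x), ⟨⟨h₂, h₁⟩, ?_⟩, ?_⟩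
      · simp [norm_smul, h0.ne']
      · simp [smul_smul, h0.ne']
    · rintro ⟨⟨t, u⟩, ⟨⟨ht₁, ht₂⟩, hu⟩, rfl⟩
      have hu' : ‖u‖ = 1 := by simpa using hu
      have ht : |t| = t := abs_of_pos (hr₁.trans ht₁)
      simpa [norm_smul, hu', ht] using ⟨ht₂, ht₁⟩
  rw [himage]
  exact (isPreconnected_Ioo.prod (isPreconnected_sphere hrank 0 1)).image _
    (continuous_fst.smul continuous_snd).continuousOn

/-- The closed annulus is the closure of the open one. -/
theorem closedAnnulus_subset_closure {r₁ r₂ : ℝ} (hr₁ : 0 < r₁) (hr : r₁ < r₂) :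
    closedAnnulus n r₁ r₂ ⊆ closure (openAnnulus n r₁ r₂) := by
  intro x hx
  rw [mem_closedAnnulus] at hx
  have h0 : 0 < ‖x‖ := hr₁.trans_le hx.2
  have hx' : x = (fun t : ℝ => t • (‖x‖⁻¹ • x)) ‖x‖ := by simp [smul_smul, h0.ne']
  have hmem : ‖x‖ ∈ closure (Set.Ioo r₁ r₂) := by
    rw [closure_Ioo hr.ne]; exact ⟨hx.2, hx.1⟩
  rw [hx']
  refine map_mem_closure (f := fun t : ℝ => t • (‖x‖⁻¹ • x)) (by fun_prop) hmem fun t ht => ?_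
  have : ‖t • (‖x‖⁻¹ • x)‖ = t := by
    simp [norm_smul, h0.ne', abs_of_pos (hr₁.trans ht.1)]
  rw [mem_openAnnulus, this]
  exact ⟨ht.2, ht.1⟩

/-! ### Bound by the outer sphere -/

/-- The maximum over the closed annulus is bounded by the values on the outer sphere. -/
theorem le_of_le_on_sphere (hn : 2 ≤ n) {r₁ r₂ : ℝ} (hr₁ : 0 < r₁) (hr : r₁ < r₂)
    {f : EuclideanSpace ℝ (Fin n) → ℝ} (hf₂ : ContDiffOn ℝ 2 f (openAnnulus n r₁ r₂))
    (hf : ContinuousOn f (closedAnnulus n r₁ r₂))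
    (hH : ∀ x ∈ openAnnulus n r₁ r₂, 0 ≤ meanCurvature f x)
    (hR : ∀ x ∈ openAnnulus n r₁ r₂, 0 ≤ scalarCurvature f x) {m : ℝ}
    (hm : ∀ x, ‖x‖ = r₂ → f x ≤ m) : ∀ x ∈ closedAnnulus n r₁ r₂, f x ≤ m := by
  have hopen : ∀ x ∈ openAnnulus n r₁ r₂, f x ≤ m := by
    intro x hx
    by_contra! hlt
    have hxc := openAnnulus_subset_closedAnnulus r₁ r₂ hx
    obtain ⟨hx₂, hx₁⟩ := mem_openAnnulus.1 hx
    obtain ⟨K, hK⟩ := (isCompact_closedAnnulus r₁ r₂).bddAbove_image hf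
    have hK' : ∀ z ∈ closedAnnulus n r₁ r₂, f z ≤ K := fun z hz => hK ⟨z, hz, rfl⟩
    set δ := f x - m with hδ
    have hδ0 : 0 < δ := sub_pos.2 hlt
    have hgap : 0 < ‖x‖ ^ 2 - r₁ ^ 2 := by nlinarith
    -- `C` makes the Gaussian equal `δ / 2` at `x`, and `α` makes it `(δ / 2) exp A` on the inner
    -- sphere. By `exp A ≥ A + 1` this exceeds `K - f x + δ`.
    set A := 2 * (|K - f x| + δ) / δ with hA
    have hA0 : 0 < A := by positivity
    set α := A / (‖x‖ ^ 2 - r₁ ^ 2) with hα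
    have hα0 : 0 < α := by positivity
    set C := δ / 2 * Real.exp (α * ‖x‖ ^ 2) with hC
    have hC0 : 0 < C := by positivity
    have hg : ∀ z : EuclideanSpace ℝ (Fin n), gaussian C α 0 z =
        δ / 2 * Real.exp (α * (‖x‖ ^ 2 - ‖z‖ ^ 2)) := by
      intro z
      rw [gaussian, hC, mul_assoc, ← Real.exp_add, sub_zero]
      ring_nf
    have hcont : ContinuousOn (fun z => f z - gaussian C α 0 z) (closedAnnulus n r₁ r₂) :=
      hf.sub (contDiff_gaussian C α 0).continuous.continuousOn
    obtain ⟨z, hz, hmax⟩ := (isCompact_closedAnnulus r₁ r₂).exists_isMaxOn ⟨x, hxc⟩ hcont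
    have hxz : f x - δ / 2 ≤ f z - gaussian C α 0 z := by
      have : f x - gaussian C α 0 x ≤ f z - gaussian C α 0 z := hmax hxc
      rw [hg x] at this
      simpa using this
    have hgz : 0 < gaussian C α 0 z := mul_pos hC0 (Real.exp_pos _)
    obtain ⟨hz₂, hz₁⟩ := mem_closedAnnulus.1 hz
    -- The value at `x` is `f x - δ / 2`. On the outer sphere the difference is below `m = f x - δ`;
    -- on the inner one the Gaussian is too large.
    have hzo : z ∈ openAnnulus n r₁ r₂ := by
      refine mem_openAnnulus.2 ⟨lt_of_le_of_ne hz₂ fun h => ?_, lt_of_le_of_ne hz₁ fun h => ?_⟩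
      · have := hm z h
        linarith
      · have h₁ := hK' z hz
        rw [hg z, ← h] at hxz
        have h₂ : α * (‖x‖ ^ 2 - r₁ ^ 2) = A := by rw [hα]; field_simp
        rw [h₂] at hxz
        have h₃ := Real.add_one_le_exp A
        have h₄ : δ / 2 * A = |K - f x| + δ := by rw [hA]; field_simp
        have h₅ := mul_le_mul_of_nonneg_left h₃ (half_pos hδ0).le
        have h₆ := le_abs_self (K - f x)
        linarith
    have hnhds := (isOpen_openAnnulus r₁ r₂).mem_nhds hzo
    have hloc : IsLocalMax (fun z => f z - gaussian C α 0 z) z :=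
      hmax.isLocalMax (mem_of_superset hnhds (openAnnulus_subset_closedAnnulus r₁ r₂))
    exact not_isLocalMax_sub_gaussian hn (hf₂.contDiffAt hnhds) (hH z hzo) (hR z hzo)
      (norm_pos_iff.1 (hr₁.trans_le hz₁)) hC0 hα0 hloc
  intro x hx
  have hx' : x ∈ closure (openAnnulus n r₁ r₂) := closedAnnulus_subset_closure hr₁ hr hx
  exact ContinuousWithinAt.closure_le hx'
    ((hf x hx).mono (openAnnulus_subset_closedAnnulus r₁ r₂)) continuousWithinAt_const hopen

/-! ### Strong maximum principle -/

/-- Points of contact with the maximum are interior to the contact set: Hopf's argument for the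
mean curvature operator. -/
theorem eq_of_dist_lt_of_isMax (hn : 1 ≤ n) {U : Set (EuclideanSpace ℝ (Fin n))} (hU : IsOpen U)
    {f : EuclideanSpace ℝ (Fin n) → ℝ} (hf : ContDiffOn ℝ 2 f U)
    (hH : ∀ x ∈ U, 0 ≤ meanCurvature f x) {m : ℝ} (hm : ∀ x ∈ U, f x ≤ m)
    {x₀ : EuclideanSpace ℝ (Fin n)} (hx₀ : f x₀ = m) {ρ : ℝ}
    (hρ : Metric.closedBall x₀ (2 * ρ) ⊆ U) {y : EuclideanSpace ℝ (Fin n)}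
    (hy : dist y x₀ < ρ) : f y = m := by
  by_contra hne
  have hρ0 : 0 < ρ := dist_nonneg.trans_lt hy
  have hfc : ContinuousOn f (Metric.closedBall x₀ (2 * ρ)) := hf.continuousOn.mono hρ
  have hcl : IsCompact (Metric.closedBall x₀ (2 * ρ) ∩ f ⁻¹' {m}) :=
    (isCompact_closedBall x₀ (2 * ρ)).of_isClosed_subset
      (hfc.preimage_isClosed_of_isClosed Metric.isClosed_closedBall isClosed_singleton)
      Set.inter_subset_left
  have hx₀mem : x₀ ∈ Metric.closedBall x₀ (2 * ρ) ∩ f ⁻¹' {m} :=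
    ⟨Metric.mem_closedBall_self (by positivity), hx₀⟩
  -- `x₁` is a contact point nearest to `y`, so `f < m` on the open ball about `y` of radius `R =
  -- dist y x₁`.
  obtain ⟨x₁, ⟨hx₁, hfx₁⟩, hmin⟩ := hcl.exists_isMinOn (f := fun z => dist y z) ⟨x₀, hx₀mem⟩
    (by fun_prop)
  have hfx₁ : f x₁ = m := hfx₁
  set R := dist y x₁ with hR
  have hRρ : R < ρ := lt_of_le_of_lt (hmin hx₀mem) hy
  have hR0 : 0 < R := dist_pos.2 fun h => hne (h ▸ hfx₁)
  have hball : ∀ z, dist z y ≤ ρ → z ∈ Metric.closedBall x₀ (2 * ρ) := fun z hz => by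
    have := dist_triangle z y x₀
    rw [Metric.mem_closedBall]
    linarith
  have hlt : ∀ z, dist z y < R → f z < m := fun z hz => by
    have hzb := hball z (by linarith)
    refine lt_of_le_of_ne (hm z (hρ hzb)) fun h => ?_
    have : R ≤ dist y z := hmin (show z ∈ _ from ⟨hzb, h⟩)
    rw [dist_comm] at this
    linarith
  obtain ⟨δ, hδ0, hδ⟩ : ∃ δ > 0, ∀ z, dist z y ≤ R / 2 → f z ≤ m - δ := by
    obtain ⟨z₀, hz₀, hz₀max⟩ := (isCompact_closedBall y (R / 2)).exists_isMaxOn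
      ⟨y, Metric.mem_closedBall_self (by positivity)⟩ (hfc.mono fun z hz => hball z
        ((Metric.mem_closedBall.1 hz).trans (by linarith)))
    refine ⟨m - f z₀, sub_pos.2 (hlt z₀ ((Metric.mem_closedBall.1 hz₀).trans_lt (by linarith))),
      fun z hz => ?_⟩
    have : f z ≤ f z₀ := hz₀max hz
    linarith
  -- This gives `α |z - y|² ≥ n` as soon as `|z - y| ≥ R / 2`.
  set α := 4 * n / R ^ 2 with hα
  have hn0 : (0 : ℝ) < n := by exact_mod_cast hn
  have hα0 : 0 < α := by positivity
  -- The first bound excludes a maximum on the inner sphere of the shell; the second keeps the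
  -- barrier's slope at most `1`.
  set ε := min (δ / 2) (1 / (2 * α * ρ)) with hε
  have hε0 : 0 < ε := lt_min (by positivity) (by positivity)
  have hεδ : ε < δ := (min_le_left _ _).trans_lt (by linarith)
  have hερ : 2 * α * ε * ρ ≤ 1 := by
    have := min_le_right (δ / 2) (1 / (2 * α * ρ))
    rw [← hε, le_div_iff₀ (by positivity)] at this
    linarith
  have hg : ∀ z, gaussian (-ε) α y z = -(ε * Real.exp (-α * dist z y ^ 2)) := fun z => by
    rw [gaussian, dist_eq_norm]; ring
  have hexp1 : ∀ z, Real.exp (-α * dist z y ^ 2) ≤ 1 := fun z =>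
    Real.exp_le_one_iff.2 (by have := sq_nonneg (dist z y); nlinarith)
  -- The shell reaches past `x₁`, to radius `ρ > R`. On its outer sphere `f ≤ m` and the added bump
  -- is smaller than at `x₁`; on its inner sphere `f ≤ m - δ` and the bump is below `δ`. So the
  -- maximum is interior.
  have hKc : IsCompact (Metric.closedBall y ρ \ Metric.ball y (R / 2)) :=
    (isCompact_closedBall y ρ).diff Metric.isOpen_ball
  have hx₁K : x₁ ∈ Metric.closedBall y ρ \ Metric.ball y (R / 2) := by
    simp only [Set.mem_sdiff, Metric.mem_closedBall, Metric.mem_ball, dist_comm x₁ y, ← hR]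
    exact ⟨hRρ.le, by linarith⟩
  obtain ⟨z, ⟨hz₁, hz₂⟩, hmax⟩ := hKc.exists_isMaxOn (f := fun z => f z - gaussian (-ε) α y z)
    ⟨x₁, hx₁K⟩ ((hfc.mono fun z hz => hball z (Metric.mem_closedBall.1 hz.1)).sub
      (contDiff_gaussian (-ε) α y).continuous.continuousOn)
  rw [Metric.mem_closedBall] at hz₁
  rw [Metric.mem_ball, not_lt] at hz₂
  have hzU : z ∈ U := hρ (hball z hz₁)
  have hxz : m + ε * Real.exp (-α * R ^ 2) ≤ f z + ε * Real.exp (-α * dist z y ^ 2) := by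
    have : f x₁ - gaussian (-ε) α y x₁ ≤ f z - gaussian (-ε) α y z := hmax hx₁K
    rw [hg, hg, dist_comm x₁ y, hfx₁] at this
    linarith
  have hz₁' : dist z y < ρ := by
    refine lt_of_le_of_ne hz₁ fun h => ?_
    rw [h] at hxz
    have h₁ := hm z hzU
    have h₂ : Real.exp (-α * ρ ^ 2) < Real.exp (-α * R ^ 2) := by
      have : R ^ 2 < ρ ^ 2 := by nlinarith
      exact Real.exp_lt_exp.2 (by nlinarith)
    have h₃ := mul_lt_mul_of_pos_left h₂ hε0
    linarith
  have hz₂' : R / 2 < dist z y := by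
    refine lt_of_le_of_ne hz₂ fun h => ?_
    have h₁ := hδ z h.ge
    have h₂ := mul_le_mul_of_nonneg_left (hexp1 z) hε0.le
    have h₃ : 0 < ε * Real.exp (-α * R ^ 2) := by positivity
    linarith
  have hnhds : Metric.closedBall y ρ \ Metric.ball y (R / 2) ∈ 𝓝 z := by
    refine mem_of_superset ((Metric.isOpen_ball.sdiff Metric.isClosed_closedBall).mem_nhds
      (show z ∈ Metric.ball y ρ \ Metric.closedBall y (R / 2) from ⟨hz₁', hz₂'.not_ge⟩)) ?_
    exact Set.sdiff_subset_sdiff Metric.ball_subset_closedBall Metric.ball_subset_closedBall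
  have hzy : z ≠ y := dist_pos.1 (by linarith)
  refine absurd (hH z hzU) (IsLocalMax.meanCurvature_neg (C := -ε) (α := α)
    (hf.contDiffAt (hU.mem_nhds hzU)) (hmax.isLocalMax hnhds) hzy (by linarith) hα0 ?_ ?_ hn).not_ge
  · rw [← dist_eq_norm, hα]
    have h : R ^ 2 ≤ 4 * dist z y ^ 2 := by nlinarith
    rw [div_mul_eq_mul_div, le_div_iff₀ (by positivity)]
    nlinarith
  · rw [← dist_eq_norm, ← mul_pow, hg, sq_le_one_iff_abs_le_one, abs_le]
    have h₁ : 0 ≤ 2 * α * ε * dist z y := by positivity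
    have h₂ : 2 * α * ε * dist z y ≤ 1 :=
      (mul_le_mul_of_nonneg_left hz₁ (by positivity)).trans hερ
    have h₃ := mul_le_mul_of_nonneg_left (hexp1 z) h₁
    have h₄ : 0 ≤ 2 * α * ε * dist z y * Real.exp (-α * dist z y ^ 2) := by positivity
    constructor <;> linarith

/-- The strong maximum principle for the mean curvature operator. -/
theorem eq_of_isMax_of_isPreconnected (hn : 1 ≤ n) {U : Set (EuclideanSpace ℝ (Fin n))}
    (hU : IsOpen U) (hUc : IsPreconnected U)
    {f : EuclideanSpace ℝ (Fin n) → ℝ} (hf : ContDiffOn ℝ 2 f U)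
    (hH : ∀ x ∈ U, 0 ≤ meanCurvature f x) {m : ℝ} (hm : ∀ x ∈ U, f x ≤ m)
    {x₀ : EuclideanSpace ℝ (Fin n)} (hx₀U : x₀ ∈ U) (hx₀ : f x₀ = m) : ∀ x ∈ U, f x = m := by
  have h₁ : IsOpen (U ∩ f ⁻¹' {m}) := by
    refine Metric.isOpen_iff.2 fun x hx => ?_
    obtain ⟨r, hr, hrU⟩ := Metric.nhds_basis_closedBall.mem_iff.1 (hU.mem_nhds hx.1)
    refine ⟨r / 2, by positivity, fun y hy => ⟨hrU ?_, ?_⟩⟩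
    · exact Metric.mem_closedBall.2 ((Metric.mem_ball.1 hy).le.trans (by linarith))
    · exact eq_of_dist_lt_of_isMax hn hU hf hH hm hx.2 (ρ := r / 2)
        (by rwa [mul_div_cancel₀ r two_ne_zero]) hy
  have h₂ : IsOpen (U ∩ f ⁻¹' {m}ᶜ) :=
    hf.continuousOn.isOpen_inter_preimage hU isClosed_singleton.isOpen_compl
  have hsub := hUc.subset_left_of_subset_union h₁ h₂
    (Set.disjoint_left.2 fun x hx hx' => hx'.2 hx.2)
    (fun x hx => (em (f x = m)).imp (fun h => ⟨hx, h⟩) fun h => ⟨hx, h⟩) ⟨x₀, hx₀U, hx₀U, hx₀⟩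
  exact fun x hx => (hsub hx).2

end GraphGeometry

/-! ### Conclusion -/

theorem mainTheorem9 (n : ℕ) (hn : 2 ≤ n) (r₁ r₂ : ℝ) (hr₁ : 0 < r₁) (hr : r₁ < r₂)
    (f : EuclideanSpace ℝ (Fin n) → ℝ)
    (hf₂ : ContDiffOn ℝ 2 f (GraphGeometry.openAnnulus n r₁ r₂))
    (hf₁ : ContDiffOn ℝ 1 f (GraphGeometry.closedAnnulus n r₁ r₂))
    (hH : ∀ x ∈ GraphGeometry.openAnnulus n r₁ r₂, 0 ≤ GraphGeometry.meanCurvature f x)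
    (hR : ∀ x ∈ GraphGeometry.openAnnulus n r₁ r₂, 0 ≤ GraphGeometry.scalarCurvature f x) :
    ∃ m : ℝ,
      IsGreatest (f '' GraphGeometry.closedAnnulus n r₁ r₂) m ∧
      IsGreatest (f '' Metric.sphere (0 : EuclideanSpace ℝ (Fin n)) r₂) m ∧
      ((∃ x ∈ GraphGeometry.openAnnulus n r₁ r₂, f x = m) →
        ∀ y ∈ GraphGeometry.closedAnnulus n r₁ r₂, f y = m) := by
  have hf : ContinuousOn f (GraphGeometry.closedAnnulus n r₁ r₂) := hf₁.continuousOn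
  have hr₂ : 0 < r₂ := hr₁.trans hr
  have : Nontrivial (EuclideanSpace ℝ (Fin n)) := by
    have : Nontrivial (Fin n) := Fin.nontrivial_iff_two_le.2 hn
    infer_instance
  have hsub : Metric.sphere (0 : EuclideanSpace ℝ (Fin n)) r₂ ⊆
      GraphGeometry.closedAnnulus n r₁ r₂ := fun x hx => by
    have hx' : ‖x‖ = r₂ := by simpa using hx
    exact GraphGeometry.mem_closedAnnulus.2 ⟨hx'.le, hx' ▸ hr.le⟩
  obtain ⟨x, hx, hmax⟩ := (isCompact_sphere (0 : EuclideanSpace ℝ (Fin n)) r₂).exists_isMaxOn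
    (NormedSpace.sphere_nonempty.2 hr₂.le) (hf.mono hsub)
  have hle := GraphGeometry.le_of_le_on_sphere hn hr₁ hr hf₂ hf hH hR (m := f x)
    fun z hz => hmax (by simpa using hz)
  refine ⟨f x, ⟨⟨x, hsub hx, rfl⟩, ?_⟩, ⟨⟨x, hx, rfl⟩, ?_⟩, ?_⟩
  · rintro _ ⟨z, hz, rfl⟩
    exact hle z hz
  · rintro _ ⟨z, hz, rfl⟩
    exact hmax hz
  · rintro ⟨x₀, hx₀, hfx₀⟩ y hy
    have hopen := GraphGeometry.eq_of_isMax_of_isPreconnected (by omega)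
      (GraphGeometry.isOpen_openAnnulus r₁ r₂) (GraphGeometry.isPreconnected_openAnnulus hn hr₁)
      hf₂ hH (fun z hz => hle z (GraphGeometry.openAnnulus_subset_closedAnnulus r₁ r₂ hz)) hx₀ hfx₀
    refine le_antisymm (hle y hy) ?_
    -- Equality on the open annulus passes to both boundary spheres by continuity.
    exact ContinuousWithinAt.closure_le (GraphGeometry.closedAnnulus_subset_closure hr₁ hr hy)
      continuousWithinAt_const
      ((hf y hy).mono (GraphGeometry.openAnnulus_subset_closedAnnulus r₁ r₂))
      fun z hz => (hopen z hz).ge
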